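/- Let $G$ be a finitely generated group that is solvable of step (derived length) at most $3$, i.e. $G^{(3)}=1$, where $G^{(0)}=G$ and $G^{(i+1)}=[G^{(i)},G^{(i)}]$. Let $X$ be any set of generators of $G$. Call an element of $G$ a palindrome (with respect to $X$) if it is represented by a reduced word in the alphabet $X^{\pm 1}$ that reads the same forwards and backwards; let the palindromic length $l_{\mathcal P}(g)$ of $g\in G$ be the least number $k$ such that $g$ is a product of $k$ palindromes, and let the palindromic width of $G$ with respect to $X$ be $$\mathrm{pw}(G,X)=\sup_{g\in G} l_{\mathcal P}(g).$$ Then $\mathrm{pw}(G,X)<\infty$. -/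

import Mathlib

/-- `g` is the value in `G` of a reduced word over the alphabet `X^{±1}` that reads the same
forwards and backwards. The letter `(x, true)` stands for `x` and `(x, false)` for `x⁻¹`. -/
def IsGroupPalindrome {G : Type*} [Group G] (X : Set G) (g : G) : Prop :=
  ∃ w : List (X × Bool), FreeGroup.IsReduced w ∧ w.reverse = w ∧
    FreeGroup.lift (fun x : X => (x : G)) (FreeGroup.mk w) = g

/-- `g` is a product of exactly `k` palindromes over `X^{±1}`. -/
def IsProdOfPalindromes {G : Type*} [Group G] (X : Set G) (k : ℕ) (g : G) : Prop :=
  ∃ l : List G, l.length = k ∧ (∀ p ∈ l, IsGroupPalindrome X p) ∧ l.prod = g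

/-- The least `k` such that `g` is a product of `k` palindromes over `X^{±1}`
(`⊤` if there is no such `k`). -/
noncomputable def palindromicLength {G : Type*} [Group G] (X : Set G) (g : G) : ℕ∞ :=
  ⨅ (k : ℕ) (_ : IsProdOfPalindromes X k g), (k : ℕ∞)

/-- The palindromic width `pw(G, X)`: the supremum of the palindromic lengths over `X^{±1}` of the
elements of `G`. -/
noncomputable def palindromicWidth {G : Type*} [Group G] (X : Set G) : ℕ∞ :=
  ⨆ g : G, palindromicLength X g

open scoped commutatorElement

/-! ### Palindromes -/

section Palindrome

variable {G : Type*} [Group G] {X : Set G}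

/-! A conjugate of a palindrome is a product of two palindromes, so for fixed `c` all commutators
`⁅a, c⁆` have bounded palindromic length. It remains to climb G ≥ G′ ≥ [G′, G] ≥ G″ ≥ [G″, G] ≥ 1
with bounded cost per layer. In each layer below G′, `a ↦ ⁅a, c⁆` is multiplicative up to order
modulo the next term, so one commutator per `c` suffices, with `c` in a finite set: generators of G,
or, for G″/[G″, G], normal generators of G′. The layer G/G′ needs one power of each generator. -/

theorem FreeGroup.Red.Step.reverse {α : Type*} {L₁ L₂ : List (α × Bool)}
    (h : FreeGroup.Red.Step L₁ L₂) : FreeGroup.Red.Step L₁.reverse L₂.reverse := by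
  cases h
  simp only [List.reverse_append, List.reverse_cons, List.append_assoc, List.cons_append,
    List.nil_append]
  exact FreeGroup.Red.Step.not_rev

/-- Reversal preserves cancellation steps, and reduced forms are unique. Hence reducing a
palindromic word leaves it palindromic. -/
theorem FreeGroup.reduce_reverse {α : Type*} [DecidableEq α] (L : List (α × Bool)) :
    FreeGroup.reduce L.reverse = (FreeGroup.reduce L).reverse := by
  have hred : FreeGroup.Red L.reverse (FreeGroup.reduce L).reverse :=
    Relation.ReflTransGen.lift List.reverse (fun _ _ h => FreeGroup.Red.Step.reverse h) _ _
      FreeGroup.reduce.red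
  have hR : FreeGroup.IsReduced (FreeGroup.reduce L).reverse := by
    rw [FreeGroup.isReduced_iff_not_step]
    intro L₂ h
    have h' := h.reverse
    rw [List.reverse_reverse] at h'
    exact (FreeGroup.IsReduced.of_reduce_eq FreeGroup.reduce.idem).not_step h'
  rw [FreeGroup.reduce.eq_of_red hred, hR.reduce_eq]

/-- The value of any palindromic word is a palindrome, whether or not the word is reduced. -/
theorem IsGroupPalindrome.of_word {w : List (X × Bool)} (hw : w.reverse = w) :
    IsGroupPalindrome X (FreeGroup.lift (fun x : X => (x : G)) (FreeGroup.mk w)) := by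
  classical
  refine ⟨FreeGroup.reduce w, FreeGroup.IsReduced.of_reduce_eq FreeGroup.reduce.idem, ?_, ?_⟩
  · rw [← FreeGroup.reduce_reverse, hw]
  · rw [FreeGroup.reduce.self]

theorem IsGroupPalindrome.one : IsGroupPalindrome X (1 : G) := by
  simpa [← FreeGroup.one_eq_mk] using IsGroupPalindrome.of_word (X := X) (w := []) rfl

theorem IsGroupPalindrome.inv {g : G} (hg : IsGroupPalindrome X g) :
    IsGroupPalindrome X g⁻¹ := by
  obtain ⟨w, -, hw, rfl⟩ := hg
  rw [← map_inv, FreeGroup.inv_mk]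
  refine IsGroupPalindrome.of_word ?_
  rw [FreeGroup.invRev, List.reverse_reverse, ← List.map_reverse, hw]

theorem IsGroupPalindrome.of_mem {x : G} (hx : x ∈ X) : IsGroupPalindrome X x := by
  simpa using IsGroupPalindrome.of_word (X := X) (w := [(⟨x, hx⟩, true)]) rfl

theorem IsGroupPalindrome.pow {x : G} (hx : x ∈ X) (n : ℕ) : IsGroupPalindrome X (x ^ n) := by
  have h := IsGroupPalindrome.of_word (X := X) (w := List.replicate n (⟨x, hx⟩, true))
    List.reverse_replicate
  simpa using h

theorem IsGroupPalindrome.zpow {x : G} (hx : x ∈ X) (n : ℤ) : IsGroupPalindrome X (x ^ n) := by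
  obtain ⟨m, rfl | rfl⟩ := n.eq_nat_or_neg
  · simpa using IsGroupPalindrome.pow hx m
  · simpa using (IsGroupPalindrome.pow hx m).inv

/-- Every element `a` of the group has a companion `b`, the value of the reversed word, such that
`a * p * b` is a palindrome for every palindrome `p`. -/
theorem exists_mul_mul_isGroupPalindrome (hX : Subgroup.closure X = ⊤) (a : G) :
    ∃ b : G, ∀ p, IsGroupPalindrome X p → IsGroupPalindrome X (a * p * b) := by
  have hsurj : Function.Surjective (FreeGroup.lift (fun x : X => (x : G))) := by
    rw [FreeGroup.lift_surjective_iff_closure_range_eq_top, Subtype.range_coe, hX]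
  obtain ⟨z, rfl⟩ := hsurj a
  induction z using Quot.inductionOn with
  | _ u =>
    refine ⟨FreeGroup.lift (fun x : X => (x : G)) (FreeGroup.mk u.reverse), ?_⟩
    rintro _ ⟨w, -, hw, rfl⟩
    have h := IsGroupPalindrome.of_word (X := X) (w := u ++ w ++ u.reverse) (by simp [hw])
    rwa [← FreeGroup.mul_mk, ← FreeGroup.mul_mk, map_mul, map_mul] at h

/-! ### Products of palindromes -/

theorem IsProdOfPalindromes.mul {m n : ℕ} {g h : G} (hg : IsProdOfPalindromes X m g)
    (hh : IsProdOfPalindromes X n h) : IsProdOfPalindromes X (m + n) (g * h) := by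
  obtain ⟨l, rfl, hl, rfl⟩ := hg
  obtain ⟨l', rfl, hl', rfl⟩ := hh
  refine ⟨l ++ l', by simp, ?_, by simp⟩
  intro p hp
  exact (List.mem_append.1 hp).elim (hl p) (hl' p)

theorem IsProdOfPalindromes.zero : IsProdOfPalindromes X 0 (1 : G) :=
  ⟨[], rfl, by simp, rfl⟩

theorem IsGroupPalindrome.isProdOfPalindromes {g : G} (hg : IsGroupPalindrome X g) :
    IsProdOfPalindromes X 1 g :=
  ⟨[g], rfl, by simpa using hg, by simp⟩

theorem IsProdOfPalindromes.inv {n : ℕ} {g : G} (hg : IsProdOfPalindromes X n g) :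
    IsProdOfPalindromes X n g⁻¹ := by
  obtain ⟨l, rfl, hl, rfl⟩ := hg
  refine ⟨(l.map (·⁻¹)).reverse, by simp, ?_, (List.prod_inv_reverse l).symm⟩
  intro p hp
  simp only [List.mem_reverse, List.mem_map] at hp
  obtain ⟨q, hq, rfl⟩ := hp
  exact (hl q hq).inv

theorem exists_isProdOfPalindromes (hX : Subgroup.closure X = ⊤) (g : G) :
    ∃ n, IsProdOfPalindromes X n g := by
  have hg : g ∈ Subgroup.closure X := hX ▸ Subgroup.mem_top g
  induction hg using Subgroup.closure_induction with
  | mem x hx => exact ⟨1, (IsGroupPalindrome.of_mem hx).isProdOfPalindromes⟩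
  | one => exact ⟨0, .zero⟩
  | mul _ _ _ _ h₁ h₂ =>
    obtain ⟨m, hm⟩ := h₁
    obtain ⟨n, hn⟩ := h₂
    exact ⟨m + n, hm.mul hn⟩
  | inv _ _ h =>
    obtain ⟨n, hn⟩ := h
    exact ⟨n, hn.inv⟩

/-- With `b` the reversal companion of `a`, a p a⁻¹ = (a p b)(a b)⁻¹, and `a * b` is a palindrome
because 1 is. -/
theorem IsGroupPalindrome.conj (hX : Subgroup.closure X = ⊤) {p : G}
    (hp : IsGroupPalindrome X p) (a : G) : IsProdOfPalindromes X 2 (a * p * a⁻¹) := by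
  obtain ⟨b, hb⟩ := exists_mul_mul_isGroupPalindrome hX a
  have h := (hb p hp).isProdOfPalindromes.mul (hb 1 .one).inv.isProdOfPalindromes
  have e : a * p * b * (a * 1 * b)⁻¹ = a * p * a⁻¹ := by group
  rwa [e] at h

theorem IsProdOfPalindromes.conj (hX : Subgroup.closure X = ⊤) {n : ℕ} {g : G}
    (hg : IsProdOfPalindromes X n g) (a : G) :
    IsProdOfPalindromes X (2 * n) (a * g * a⁻¹) := by
  obtain ⟨l, rfl, hl, rfl⟩ := hg
  induction l with
  | nil => simpa using IsProdOfPalindromes.zero (X := X)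
  | cons p l ih =>
    have h := ((hl p (by simp)).conj hX a).mul (ih fun q hq => hl q (by simp [hq]))
    have e : a * p * a⁻¹ * (a * l.prod * a⁻¹) = a * (p :: l).prod * a⁻¹ := by
      rw [List.prod_cons]; group
    have e' : 2 + 2 * l.length = 2 * (p :: l).length := by rw [List.length_cons]; ring
    rwa [e, e'] at h

/-- For fixed `c`, the commutators `⁅a, c⁆` have uniformly bounded palindromic length. -/
theorem exists_isProdOfPalindromes_commutator (hX : Subgroup.closure X = ⊤) (c : G) :
    ∃ n, ∀ a : G, IsProdOfPalindromes X n ⁅a, c⁆ := by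
  obtain ⟨n, hn⟩ := exists_isProdOfPalindromes hX c
  exact ⟨2 * n + n, fun a => (hn.conj hX a).mul hn.inv⟩

end Palindrome

/-! ### Palindromic width of a subgroup relative to another one -/

section RelativeWidth

variable {G : Type*} [Group G] {X : Set G}

/-- There is a uniform `n` such that every element of `H` is, up to right multiplication by an
element of `L`, a product of `n` palindromes. -/
def FinitePalindromicWidthMod (X : Set G) (H L : Subgroup G) : Prop :=
  ∃ n, ∀ g ∈ H, ∃ h, IsProdOfPalindromes X n h ∧ h⁻¹ * g ∈ L

theorem FinitePalindromicWidthMod.refl (L : Subgroup G) : FinitePalindromicWidthMod X L L :=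
  ⟨0, fun g hg => ⟨1, .zero, by simpa using hg⟩⟩

theorem FinitePalindromicWidthMod.mono {H H' L : Subgroup G}
    (h : FinitePalindromicWidthMod X H L) (hH : H' ≤ H) : FinitePalindromicWidthMod X H' L := by
  obtain ⟨n, hn⟩ := h
  exact ⟨n, fun g hg => hn g (hH hg)⟩

theorem FinitePalindromicWidthMod.trans {H K L : Subgroup G}
    (h₁ : FinitePalindromicWidthMod X H K) (h₂ : FinitePalindromicWidthMod X K L) :
    FinitePalindromicWidthMod X H L := by
  obtain ⟨m, hm⟩ := h₁
  obtain ⟨n, hn⟩ := h₂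
  refine ⟨m + n, fun g hg => ?_⟩
  obtain ⟨h, hh, hk⟩ := hm g hg
  obtain ⟨h', hh', hl⟩ := hn _ hk
  exact ⟨h * h', hh.mul hh', by simpa [mul_assoc] using hl⟩

theorem FinitePalindromicWidthMod.palindromicWidth_lt_top
    (h : FinitePalindromicWidthMod X (⊤ : Subgroup G) ⊥) : palindromicWidth X < ⊤ := by
  obtain ⟨n, hn⟩ := h
  refine lt_of_le_of_lt (iSup_le fun g => ?_) (ENat.natCast_lt_top n)
  obtain ⟨h, hh, hg⟩ := hn g trivial
  obtain rfl : h = g := inv_mul_eq_one.1 (Subgroup.mem_bot.1 hg)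
  exact iInf₂_le n hh

/-- If `a ↦ ⁅a, c⁆` is multiplicative on `A` modulo `K`, then the products `k * ⁅a, c⁆` form a
subgroup. -/
def Subgroup.mulCommutators (A K : Subgroup G) (c : G) [A.Normal]
    (hK : ∀ a ∈ A, ∀ k ∈ K, a * k * a⁻¹ ∈ K) (hc : ∀ a ∈ A, ∀ b ∈ A, ⁅a, ⁅b, c⁆⁆ ∈ K) :
    Subgroup G where
  carrier := {g | ∃ k ∈ K, ∃ a ∈ A, g = k * ⁅a, c⁆}
  one_mem' := ⟨1, K.one_mem, 1, A.one_mem, by simp⟩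
  mul_mem' := by
    rintro _ _ ⟨k, hk, a, ha, rfl⟩ ⟨k', hk', b, hb, rfl⟩
    have hac : ⁅a, c⁆ ∈ A :=
      Subgroup.commutator_le_left A ⊤ (Subgroup.commutator_mem_commutator ha (Subgroup.mem_top c))
    -- From ⁅ba, c⁆ = ⁅b, ⁅a, c⁆⁆ ⁅a, c⁆ ⁅b, c⁆; the order of `a` and `b` is reversed.
    refine ⟨k * (⁅a, c⁆ * k' * ⁅a, c⁆⁻¹) * ⁅b, ⁅a, c⁆⁆⁻¹,
      K.mul_mem (K.mul_mem hk (hK _ hac _ hk')) (K.inv_mem (hc b hb a ha)),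
      b * a, A.mul_mem hb ha, ?_⟩
    simp only [commutatorElement_def]; group
  inv_mem' := by
    rintro _ ⟨k, hk, a, ha, rfl⟩
    have hac : ⁅a, c⁆ ∈ A :=
      Subgroup.commutator_le_left A ⊤ (Subgroup.commutator_mem_commutator ha (Subgroup.mem_top c))
    -- The same identity for a · a⁻¹ = 1 gives ⁅a, c⁆⁻¹ = ⁅a, ⁅a⁻¹, c⁆⁆ ⁅a⁻¹, c⁆.
    refine ⟨⁅a, c⁆⁻¹ * k⁻¹ * ⁅a, c⁆⁻¹⁻¹ * ⁅a, ⁅a⁻¹, c⁆⁆,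
      K.mul_mem (hK _ (A.inv_mem hac) _ (K.inv_mem hk)) (hc a ha _ (A.inv_mem ha)),
      a⁻¹, A.inv_mem ha, ?_⟩
    simp only [commutatorElement_def]; group

/-- Adjoining to `L` the commutators of elements of `A` with finitely many fixed elements keeps the
palindromic width modulo `L` finite. -/
theorem exists_finitePalindromicWidthMod_commutators (hX : Subgroup.closure X = ⊤)
    (A L : Subgroup G) [A.Normal] [L.Normal] {C : Set G} (hC : C.Finite)
    (hAC : ∀ c ∈ C, ∀ a ∈ A, ∀ b ∈ A, ⁅a, ⁅b, c⁆⁆ ∈ L) :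
    ∃ K : Subgroup G, L ≤ K ∧ (∀ a ∈ A, ∀ k ∈ K, a * k * a⁻¹ ∈ K) ∧
      (∀ c ∈ C, ∀ a ∈ A, ⁅a, c⁆ ∈ K) ∧ FinitePalindromicWidthMod X K L := by
  induction C, hC using Set.Finite.induction_on with
  | empty => exact ⟨L, le_rfl, fun a _ k hk => ‹L.Normal›.conj_mem k hk a, by simp, .refl L⟩
  | @insert c C _ _ ih =>
    obtain ⟨K, hLK, hAK, hCK, n, hn⟩ := ih fun d hd => hAC d (Set.mem_insert_of_mem c hd)
    have hc : ∀ a ∈ A, ∀ b ∈ A, ⁅a, ⁅b, c⁆⁆ ∈ K := fun a ha b hb =>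
      hLK (hAC c (Set.mem_insert c C) a ha b hb)
    have hle : K ≤ A.mulCommutators K c hAK hc := fun k hk =>
      ⟨k, hk, 1, A.one_mem, by simp⟩
    obtain ⟨m, hm⟩ := exists_isProdOfPalindromes_commutator hX c
    refine ⟨A.mulCommutators K c hAK hc, hLK.trans hle, ?_, ?_, n + m, ?_⟩
    · rintro a ha _ ⟨k, hk, b, hb, rfl⟩
      refine ⟨a * k * a⁻¹ * ⁅a, ⁅b, c⁆⁆, K.mul_mem (hAK a ha k hk) (hc a ha b hb), b, hb, ?_⟩
      simp only [commutatorElement_def]; group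
    · rintro d (rfl | hd) a ha
      · exact ⟨1, K.one_mem, a, ha, by simp⟩
      · exact hle (hCK d hd a ha)
    · rintro _ ⟨k, hk, a, ha, rfl⟩
      obtain ⟨h, hh, hl⟩ := hn k hk
      refine ⟨h * ⁅a, c⁆, hh.mul (hm a), ?_⟩
      have := ‹L.Normal›.conj_mem _ hl ⁅a, c⁆⁻¹
      simpa [mul_assoc] using this

/-- The elements whose commutators with the normal subgroup `A` all lie in `K`. -/
def Subgroup.commutatorTransporter (A K : Subgroup G) [hA : A.Normal] : Subgroup G where
  carrier := {b | ∀ a ∈ A, ⁅a, b⁆ ∈ K}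
  one_mem' := fun a _ => by simp
  mul_mem' := by
    intro b b' hb hb' a ha
    have e : ⁅a, b * b'⁆ = ⁅a, b'⁆ * ⁅b' * a * b'⁻¹, b⁆ := by
      simp only [commutatorElement_def]; group
    rw [e]
    exact K.mul_mem (hb' a ha) (hb _ (hA.conj_mem a ha b'))
  inv_mem' := by
    intro b hb a ha
    have e : ⁅a, b⁻¹⁆ = ⁅b⁻¹ * a * b⁻¹⁻¹, b⁆⁻¹ := by
      simp only [commutatorElement_def]; group
    rw [e]
    exact K.inv_mem (hb _ (hA.conj_mem a ha b⁻¹))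

/-- Finitely many `c` suffice: the elements whose commutators with `A` lie in `K` form a subgroup,
and it contains `S`. -/
theorem FinitePalindromicWidthMod.commutator_top (hX : Subgroup.closure X = ⊤)
    {S : Set G} (hS : S.Finite) (hSG : Subgroup.closure S = ⊤) (A L : Subgroup G)
    [A.Normal] [L.Normal] (hL : ⁅A, ⁅A, (⊤ : Subgroup G)⁆⁆ ≤ L) :
    FinitePalindromicWidthMod X ⁅A, (⊤ : Subgroup G)⁆ L := by
  obtain ⟨K, -, -, hCK, hK⟩ := exists_finitePalindromicWidthMod_commutators hX A L hS
    fun c _ a ha b hb => hL (Subgroup.commutator_mem_commutator ha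
      (Subgroup.commutator_mem_commutator hb (Subgroup.mem_top c)))
  refine hK.mono (Subgroup.commutator_le.2 fun a ha g _ => ?_)
  have hle : Subgroup.closure S ≤ A.commutatorTransporter K :=
    (Subgroup.closure_le _).2 fun c hc => hCK c hc
  exact hle (hSG ▸ Subgroup.mem_top g) a ha

/-- Modulo [[A, A], G] the subgroup [A, A] is central, so ⁅a, gcg⁻¹⁆ ≡ ⁅g⁻¹ag, c⁆ and conjugates of
`C` contribute nothing new. -/
theorem FinitePalindromicWidthMod.commutator_normalClosure (hX : Subgroup.closure X = ⊤)
    {C : Set G} (hC : C.Finite) (A : Subgroup G) [A.Normal] (hA : A = Subgroup.normalClosure C) :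
    FinitePalindromicWidthMod X ⁅A, A⁆ ⁅⁅A, A⁆, (⊤ : Subgroup G)⁆ := by
  have hCA : ∀ c ∈ C, c ∈ A := fun c hc => hA ▸ Subgroup.subset_normalClosure hc
  obtain ⟨K, hLK, -, hCK, hK⟩ := exists_finitePalindromicWidthMod_commutators hX A
    ⁅⁅A, A⁆, (⊤ : Subgroup G)⁆ hC fun c hc a _ b hb => by
      rw [Subgroup.commutator_comm]
      exact Subgroup.commutator_mem_commutator (Subgroup.mem_top _)
        (Subgroup.commutator_mem_commutator hb (hCA c hc))
  refine hK.mono (Subgroup.commutator_le.2 fun a ha b hb => ?_)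
  have hle : Subgroup.normalClosure C ≤ A.commutatorTransporter K := by
    refine (Subgroup.closure_le _).2 fun x hx a ha => ?_
    obtain ⟨c, hc, hcx⟩ := Group.mem_conjugatesOfSet_iff.1 hx
    obtain ⟨g, rfl⟩ := isConj_iff.1 hcx
    have ha' : g⁻¹ * a * g ∈ A := by simpa using ‹A.Normal›.conj_mem a ha g⁻¹
    have e : ⁅a, g * c * g⁻¹⁆ = ⁅g, ⁅g⁻¹ * a * g, c⁆⁆ * ⁅g⁻¹ * a * g, c⁆ := by
      simp only [commutatorElement_def]; group
    rw [e]
    refine K.mul_mem (hLK ?_) (hCK c hc _ ha')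
    rw [Subgroup.commutator_comm]
    exact Subgroup.commutator_mem_commutator (Subgroup.mem_top _)
      (Subgroup.commutator_mem_commutator ha' (hCA c hc))
  exact hle (hA ▸ hb) a ha

/-- Modulo the normal closure the generators commute pairwise, so the quotient is abelian. -/
theorem commutator_eq_normalClosure_of_closure_eq_top {S : Set G}
    (hS : Subgroup.closure S = ⊤) :
    commutator G = Subgroup.normalClosure (Set.image2 (fun x y => ⁅x, y⁆) S S) := by
  set N := Subgroup.normalClosure (Set.image2 (fun x y : G => ⁅x, y⁆) S S)
  apply le_antisymm
  · refine Subgroup.commutator_le.2 fun x _ y _ => ?_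
    have hx : x ∈ Subgroup.closure S := hS ▸ Subgroup.mem_top x
    have hy : y ∈ Subgroup.closure S := hS ▸ Subgroup.mem_top y
    rw [← QuotientGroup.eq_one_iff, ← QuotientGroup.mk'_apply, map_commutatorElement,
      commutatorElement_eq_one_iff_commute]
    induction hx, hy using Subgroup.closure_induction₂ with
    | mem x y hx hy =>
      rw [← commutatorElement_eq_one_iff_commute, ← map_commutatorElement,
        QuotientGroup.mk'_apply, QuotientGroup.eq_one_iff]
      exact Subgroup.subset_normalClosure ⟨x, hx, y, hy, rfl⟩
    | one_left => simp
    | one_right => simp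
    | mul_left _ _ _ _ _ _ h₁ h₂ =>
      simpa only [map_mul] using (h₁ trivial trivial).mul_left (h₂ trivial trivial)
    | mul_right _ _ _ _ _ _ h₁ h₂ =>
      simpa only [map_mul] using (h₁ trivial trivial).mul_right (h₂ trivial trivial)
    | inv_left _ _ _ _ h => simpa only [map_inv] using (h trivial trivial).inv_left
    | inv_right _ _ _ _ h => simpa only [map_inv] using (h trivial trivial).inv_right
  · refine Subgroup.normalClosure_le_normal ?_
    rintro _ ⟨x, -, y, -, rfl⟩
    exact Subgroup.commutator_mem_commutator trivial trivial

theorem FinitePalindromicWidthMod.top_commutator {S : Set G} (hS : S.Finite) (hSX : S ⊆ X)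
    (hSG : Subgroup.closure S = ⊤) :
    FinitePalindromicWidthMod X (⊤ : Subgroup G) (commutator G) := by
  suffices h : FinitePalindromicWidthMod X (commutator G ⊔ Subgroup.closure S) (commutator G) by
    rwa [hSG, sup_top_eq] at h
  clear hSG
  induction S, hS using Set.Finite.induction_on with
  | empty => simpa using FinitePalindromicWidthMod.refl (X := X) (commutator G)
  | @insert x S _ _ ih =>
    refine FinitePalindromicWidthMod.trans ?_ (ih ((Set.subset_insert x S).trans hSX))
    have : (commutator G ⊔ Subgroup.closure S).Normal := .of_commutator_le G le_sup_left
    refine ⟨1, fun g hg => ?_⟩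
    rw [Set.insert_eq, Subgroup.closure_union, ← sup_assoc, sup_comm (commutator G), sup_assoc,
      Subgroup.mem_sup_of_normal_right] at hg
    obtain ⟨y, hy, z, hz, rfl⟩ := hg
    obtain ⟨n, rfl⟩ := Subgroup.mem_closure_singleton.1 hy
    exact ⟨x ^ n, (IsGroupPalindrome.zpow (hSX (Set.mem_insert x S)) n).isProdOfPalindromes,
      by simpa using hz⟩

theorem Subgroup.exists_finite_subset_mem_closure {g : G} (hg : g ∈ Subgroup.closure X) :
    ∃ S ⊆ X, S.Finite ∧ g ∈ Subgroup.closure S := by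
  induction hg using Subgroup.closure_induction with
  | mem x hx => exact ⟨{x}, by simpa using hx, Set.finite_singleton x, Subgroup.subset_closure rfl⟩
  | one => exact ⟨∅, Set.empty_subset X, Set.finite_empty, Subgroup.one_mem _⟩
  | mul _ _ _ _ h₁ h₂ =>
    obtain ⟨S, hSX, hS, h₁⟩ := h₁
    obtain ⟨T, hTX, hT, h₂⟩ := h₂
    exact ⟨S ∪ T, Set.union_subset hSX hTX, hS.union hT, Subgroup.mul_mem _
      (Subgroup.closure_mono Set.subset_union_left h₁)
      (Subgroup.closure_mono Set.subset_union_right h₂)⟩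
  | inv _ _ h =>
    obtain ⟨S, hSX, hS, h⟩ := h
    exact ⟨S, hSX, hS, Subgroup.inv_mem _ h⟩

/-- `X` may be infinite; choosing `S` inside `X` makes powers of its elements palindromes. -/
theorem Group.FG.exists_finite_subset_closure_eq_top [Group.FG G]
    (hX : Subgroup.closure X = ⊤) : ∃ S ⊆ X, S.Finite ∧ Subgroup.closure S = ⊤ := by
  obtain ⟨T, hT, hTfin⟩ := Group.fg_iff.1 ‹Group.FG G›
  choose f hfX hf hmem using fun g : G =>
    Subgroup.exists_finite_subset_mem_closure (X := X) (g := g) (hX ▸ Subgroup.mem_top g)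
  refine ⟨⋃ t ∈ T, f t, Set.iUnion₂_subset fun t _ => hfX t, hTfin.biUnion fun t _ => hf t, ?_⟩
  rw [eq_top_iff, ← hT, Subgroup.closure_le]
  exact fun t ht => Subgroup.closure_mono (Set.subset_biUnion_of_mem ht) (hmem t)

end RelativeWidth

theorem corollary1p3 {G : Type*} [Group G] [Group.FG G] (hG : derivedSeries G 3 = ⊥)
    (X : Set G) (hX : Subgroup.closure X = ⊤) :
    palindromicWidth X < ⊤ := by
  obtain ⟨S, hSX, hS, hSG⟩ := Group.FG.exists_finite_subset_closure_eq_top hX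
  have hcomm : derivedSeries G 1 = Subgroup.normalClosure (Set.image2 (fun x y => ⁅x, y⁆) S S) := by
    rw [derivedSeries_one, commutator_eq_normalClosure_of_closure_eq_top hSG]
  have h₁ : FinitePalindromicWidthMod X ⊤ (derivedSeries G 1) := by
    rw [derivedSeries_one]
    exact .top_commutator hS hSX hSG
  have h₂ : FinitePalindromicWidthMod X (derivedSeries G 1) ⁅derivedSeries G 1, ⊤⁆ := by
    refine (FinitePalindromicWidthMod.commutator_top hX hS hSG ⊤ _ ?_).mono ?_
    · rw [Subgroup.commutator_comm, derivedSeries_one, commutator_def]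
    · rw [derivedSeries_one, commutator_def]
  -- Here A = G′, and [G′, [G′, G]] ≤ [G′, G′] = G″.
  have h₃ : FinitePalindromicWidthMod X ⁅derivedSeries G 1, ⊤⁆ (derivedSeries G 2) :=
    .commutator_top hX hS hSG _ _
      (Subgroup.commutator_mono le_rfl (Subgroup.commutator_le_left _ _))
  have h₄ : FinitePalindromicWidthMod X (derivedSeries G 2) ⁅derivedSeries G 2, ⊤⁆ :=
    .commutator_normalClosure hX (hS.image2 _ hS) (derivedSeries G 1) hcomm
  -- Here A = G″, and [G″, [G″, G]] ≤ G‴ = 1: the only use of solvability.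
  have h₅ : FinitePalindromicWidthMod X ⁅derivedSeries G 2, ⊤⁆ ⊥ :=
    .commutator_top hX hS hSG _ _
      ((Subgroup.commutator_mono le_rfl (Subgroup.commutator_le_left _ _)).trans hG.le)
  exact ((((h₁.trans h₂).trans h₃).trans h₄).trans h₅).palindromicWidth_lt_top
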